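/- **Conventions.** A *bcm space* is a non-empty metric space in which every closed bounded set is compact. $\mathbf{BCM}$ is the category of bcm spaces and isometric (i.e. distance-preserving) embeddings, $\mathbf{BCM}_\bullet$ the category of rooted bcm spaces $(X,\rho_X)$, $\rho_X\in X$, and root-preserving isometric embeddings, and $\mathbf{MTop}$ the category of metrizable topological spaces and topological embeddings. A *structure* is a functor $\tau:\mathbf{BCM}\to\mathbf{MTop}$, written $X\mapsto\tau(X)$, $f\mapsto\tau_f$. Put $\tau^\bullet(X,\rho_X)=\tau(X)$, $\tau^\bullet_f=\tau_f$ on $\mathbf{BCM}_\bullet$, and $\tau^\times(X)=\tau(X)\times X$, $\tau^\times_f=\tau_f\times f$ on $\mathbf{BCM}$. A *metrization* of a functor $F$ from a category to $\mathbf{MTop}$ is a choice, for each object $X$, of a metric $d_{F(X)}$ inducing the topology of $F(X)\neq\emptyset$, such that all maps $F_f$ are distance-preserving; it is *complete* if all these metrics are complete. *Stably metrizable.* $\tau$ is stably metrizable if $\tau^\times$ has a metrization for which there is $\delta:[0,\infty)\to[0,\infty)$ with $\lim_{\varepsilon\to0}\delta(\varepsilon)=\delta(0)=0$ such that, for all bcm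 spaces $X,Y,M_1,M_2$, all isometric embeddings $f_i:X\to M_i$, $g_i:Y\to M_i$ ($i=1,2$) and all $\varepsilon\ge0$: if $d_{M_2}(f_2(x),g_2(y))\le d_{M_1}(f_1(x),g_1(y))+\varepsilon$ for all $x\in X$, $y\in Y$, then $$d_{\tau^\times(M_2)}(\tau^\times_{f_2}(a),\tau^\times_{g_2}(b))\le d_{\tau^\times(M_1)}(\tau^\times_{f_1}(a),\tau^\times_{g_1}(b))+\delta(\varepsilon)\qquad\text{for all }a\in\tau^\times(X),\ b\in\tau^\times(Y).$$ *Continuous.* $\tau$ is continuous if (a) whenever isometric embeddings $f_n:X\to Y$ converge to an isometric embedding $f:X\to Y$ uniformly on compact sets, $\tau_{f_n}(a)\to\tau_f(a)$ for all $a\in\tau(X)$; and, whenever $f_n:X_n\to Y$, $f:X_\infty\to Y$ are isometric embeddings of bcm spaces with $f_n(X_n)\to f(X_\infty)$ in the Fell topology on closed subsets of $Y$, (b) if $a_n\in\tau(X_n)$ and $\tau_{f_n}(a_n)\to b$ in $\tau(Y)$, then $b\in\tau_f(\tau(X_\infty))$; and (c) for every $a\in\tau(X_\infty)$ there are a subsequence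 $(n_k)$ and $a_k\in\tau(X_{n_k})$ with $\tau_{f_{n_k}}(a_k)\to\tau_f(a)$ in $\tau(Y)$. It is *separable* if every $\tau(X)$ is separable. *Polish with preserved roots.* $\tau$ is Polish with preserved roots if there are a structure $\tilde\tau$, a natural transformation $\eta:\tau\Rightarrow\tilde\tau$ (in $\mathbf{MTop}$, so each $\eta_X:\tau(X)\to\tilde\tau(X)$ is a topological embedding), and, for each $k\ge1$, subsets $\tilde\tau^\bullet_k(X,\rho_X)\subseteq\tilde\tau(X)$ for all rooted bcm spaces $(X,\rho_X)$, such that (P1) $\tilde\tau$ is continuous and separable, and $\tilde\tau^\bullet$ has a complete metrization; (P2) each $\tilde\tau^\bullet_k(X,\rho_X)$ is open in $\tilde\tau(X)$, and $\tilde\tau_f^{-1}(\tilde\tau^\bullet_k(Y,\rho_Y))=\tilde\tau^\bullet_k(X,\rho_X)$ for every root-preserving isometric embedding $f:(X,\rho_X)\to(Y,\rho_Y)$; (P3) $\eta_X(\tau(X))=\bigcap_{k\ge1}\tilde\tau^\bullet_k(X,\rho_X)$ for every $(X,\rho_X)$. **Theorem.** Let $\sigma$ be a structure that is stably metrizable and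 Polish with preserved roots. Let $\tau_{\mathcal P}(\sigma)$ be the structure that assigns to each bcm space $X$ the space of Borel probability measures on $\sigma(X)$ with the weak topology, and to each isometric embedding $f$ the push-forward map $(\sigma_f)_*$. Then $\tau_{\mathcal P}(\sigma)$ is stably metrizable and Polish with preserved roots. -/

import Mathlib

open CategoryTheory TopologicalSpace Filter Topology MeasureTheory
open scoped NNReal

universe u

/-! ### The categories -/

/-- A boundedly-compact (i.e. proper) non-empty metric space. -/
structure BCM : Type (u + 1) where
  of ::
  carrier : Type u
  [metricSpace : MetricSpace carrier]
  [properSpace : ProperSpace carrier]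
  [nonempty : Nonempty carrier]

namespace BCM

instance : CoeSort BCM.{u} (Type u) := ⟨BCM.carrier⟩

attribute [instance] BCM.metricSpace BCM.properSpace BCM.nonempty

/-- Morphisms of boundedly-compact spaces: isometric embeddings (not necessarily surjective). -/
@[ext]
structure Hom (X Y : BCM.{u}) : Type u where
  toFun : X → Y
  isometry : Isometry toFun

instance : Category.{u} BCM.{u} where
  Hom X Y := Hom X Y
  id X := ⟨id, isometry_id⟩
  comp f g := ⟨g.toFun ∘ f.toFun, g.isometry.comp f.isometry⟩

end BCM

/-- A rooted boundedly-compact metric space. -/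
structure RootedBCM : Type (u + 1) where
  space : BCM.{u}
  root : space

namespace RootedBCM

/-- Morphisms of rooted boundedly-compact spaces: root-preserving isometric embeddings. -/
@[ext]
structure Hom (X Y : RootedBCM.{u}) : Type u where
  hom : X.space ⟶ Y.space
  map_root : hom.toFun X.root = Y.root

instance : Category.{u} RootedBCM.{u} where
  Hom X Y := Hom X Y
  id X := ⟨𝟙 X.space, rfl⟩
  comp f g := ⟨f.hom ≫ g.hom, (congrArg g.hom.toFun f.map_root).trans g.map_root⟩

/-- The functor that forgets the root. -/
def forgetRoot : RootedBCM.{u} ⥤ BCM.{u} where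
  obj X := X.space
  map f := f.hom

end RootedBCM

/-- A metrizable topological space. -/
structure MTop : Type (u + 1) where
  of ::
  carrier : Type u
  [topologicalSpace : TopologicalSpace carrier]
  [metrizableSpace : MetrizableSpace carrier]

namespace MTop

instance : CoeSort MTop.{u} (Type u) := ⟨MTop.carrier⟩

attribute [instance] MTop.topologicalSpace MTop.metrizableSpace

/-- Morphisms of metrizable spaces: topological embeddings. -/
@[ext]
structure Hom (S T : MTop.{u}) : Type u where
  toFun : S → T
  isEmbedding : IsEmbedding toFun

instance : Category.{u} MTop.{u} where
  Hom S T := Hom S T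
  id S := ⟨id, .id⟩
  comp f g := ⟨g.toFun ∘ f.toFun, g.isEmbedding.comp f.isEmbedding⟩

/-- Metrizable spaces always carry their Borel σ-algebra. -/
instance (S : MTop.{u}) : MeasurableSpace S := borel S

instance (S : MTop.{u}) : BorelSpace S := ⟨rfl⟩

end MTop

/-! ### Metrizations and subfunctors of functors into metrizable spaces -/

section Functors

variable {C : Type (u + 1)} [Category.{u} C]

/-- A metrization of `F : C ⥤ MTop`, i.e. a lift of `F` through the forgetful functor from the
category of non-empty metric spaces and isometric embeddings. Such a lift is the same thing as a
choice of compatible metrics on the (non-empty) spaces `F.obj X` for which all the maps `F.map f`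
are distance-preserving. -/
structure Metrization (F : C ⥤ MTop.{u}) where
  metric : ∀ X : C, MetricSpace (F.obj X)
  nonempty : ∀ X : C, Nonempty (F.obj X)
  topology_eq : ∀ X : C,
    (metric X).toUniformSpace.toTopologicalSpace = (F.obj X).topologicalSpace
  dist_map : ∀ {X Y : C} (f : X ⟶ Y) (a b : F.obj X),
    (metric Y).dist ((F.map f).toFun a) ((F.map f).toFun b) = (metric X).dist a b

/-- A metrization is complete if all of its metrics are. -/
def Metrization.IsComplete {F : C ⥤ MTop.{u}} (m : Metrization F) : Prop :=
  ∀ X : C, @CompleteSpace (F.obj X) (m.metric X).toUniformSpace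

/-- A subfunctor of `F : C ⥤ MTop` (every subset carries the relative topology). -/
structure MTopSubfunctor (F : C ⥤ MTop.{u}) where
  carrier : ∀ X : C, Set (F.obj X)
  map_mem : ∀ {X Y : C} (f : X ⟶ Y), ∀ a ∈ carrier X, (F.map f).toFun a ∈ carrier Y

/-- A subfunctor is open if it is objectwise open. -/
def MTopSubfunctor.Open {F : C ⥤ MTop.{u}} (G : MTopSubfunctor F) : Prop :=
  ∀ X : C, IsOpen (G.carrier X)

/-- A subfunctor `G` of `F` is pullback-stable if `(F f)⁻¹ (G Y) = G X` for all `f : X ⟶ Y`. -/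
def MTopSubfunctor.PullbackStable {F : C ⥤ MTop.{u}} (G : MTopSubfunctor F) : Prop :=
  ∀ {X Y : C} (f : X ⟶ Y), (F.map f).toFun ⁻¹' G.carrier Y = G.carrier X

end Functors

/-- Stability of a metrization of a functor `F : BCM ⥤ MTop`: a deformation of the ambient space
of size `ε` changes distances between embedded elements by at most `δ ε`, where the distortion `δ`
is independent of the spaces and vanishes continuously at `0`. -/
def Metrization.IsStable {F : BCM.{u} ⥤ MTop.{u}} (m : Metrization F) : Prop :=
  ∃ δ : ℝ≥0 → ℝ≥0, δ 0 = 0 ∧ Tendsto δ (𝓝 0) (𝓝 0) ∧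
    ∀ (X Y M₁ M₂ : BCM.{u}) (f₁ : X ⟶ M₁) (f₂ : X ⟶ M₂) (g₁ : Y ⟶ M₁) (g₂ : Y ⟶ M₂) (ε : ℝ≥0),
      (∀ (x : X) (y : Y), dist (f₂.toFun x) (g₂.toFun y) ≤ dist (f₁.toFun x) (g₁.toFun y) + ε) →
      ∀ (a : F.obj X) (b : F.obj Y),
        (m.metric M₂).dist ((F.map f₂).toFun a) ((F.map g₂).toFun b) ≤
          (m.metric M₁).dist ((F.map f₁).toFun a) ((F.map g₁).toFun b) + δ ε

/-! ### The Fell topology -/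

/-- The Fell topology on the closed subsets of `Y`: it is generated by the sets
`{A | A ∩ U ≠ ∅}`, `U` open, and `{A | A ∩ K = ∅}`, `K` compact. -/
@[reducible]
def fellTopology (Y : Type u) [TopologicalSpace Y] : TopologicalSpace (Closeds Y) :=
  generateFrom
    ({s | ∃ U : Set Y, IsOpen U ∧ s = {A : Closeds Y | ((A : Set Y) ∩ U).Nonempty}} ∪
      {s | ∃ K : Set Y, IsCompact K ∧ s = {A : Closeds Y | Disjoint (A : Set Y) K}})

/-- The image of an isometric embedding, as a closed set. -/
def BCM.Hom.closedRange {X Y : BCM.{u}} (f : BCM.Hom X Y) : Closeds Y :=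
  ⟨Set.range f.toFun, f.isometry.isClosedEmbedding.isClosed_range⟩

/-- `fₙ(Xₙ) → f(X)` in the Fell topology as subsets of `Y`. -/
def FellConverges {X : ℕ → BCM.{u}} {X' Y : BCM.{u}} (f : ∀ n, X n ⟶ Y) (f' : X' ⟶ Y) : Prop :=
  Tendsto (fun n => BCM.Hom.closedRange (f n)) atTop
    (@nhds _ (fellTopology Y) (BCM.Hom.closedRange f'))

/-! ### Structures -/

/-- A structure: a functor from boundedly-compact metric spaces and isometric embeddings to
metrizable spaces and topological embeddings. -/
abbrev BCMStructure : Type (u + 1) := BCM.{u} ⥤ MTop.{u}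

namespace BCMStructure

/-- The functor `(X, ρ) ↦ τ(X)` on rooted spaces. -/
abbrev spaceRooted (τ : BCMStructure.{u}) : RootedBCM.{u} ⥤ MTop.{u} :=
  RootedBCM.forgetRoot ⋙ τ

/-- The functor `X ↦ τ(X) × X`, `f ↦ τ_f × f`. -/
def elementRooted (τ : BCMStructure.{u}) : BCMStructure.{u} where
  obj X := MTop.of (τ.obj X × X)
  map f := ⟨Prod.map (τ.map f).toFun f.toFun,
    (τ.map f).isEmbedding.prodMap f.isometry.isEmbedding⟩
  map_id X := by rw [τ.map_id]; rfl
  map_comp f g := by rw [τ.map_comp]; rfl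

/-- A structure is stably metrizable if it admits a stable element-rooted metrization. -/
def StablyMetrizable (τ : BCMStructure.{u}) : Prop :=
  ∃ m : Metrization τ.elementRooted, m.IsStable

/-- A structure is separable if all the spaces `τ(X)` are. -/
def Separable (τ : BCMStructure.{u}) : Prop :=
  ∀ X : BCM.{u}, SeparableSpace (τ.obj X)

/-- If `fₙ → f` uniformly on compact sets, then `τ_{fₙ}(a) → τ_f(a)` for all `a`. -/
def EmbeddingContinuous (τ : BCMStructure.{u}) : Prop :=
  ∀ (X Y : BCM.{u}) (f : ℕ → (X ⟶ Y)) (f' : X ⟶ Y),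
    (∀ K : Set X, IsCompact K → TendstoUniformlyOn (fun n => (f n).toFun) f'.toFun atTop K) →
    ∀ a : τ.obj X, Tendsto (fun n => (τ.map (f n)).toFun a) atTop (𝓝 ((τ.map f').toFun a))

/-- Upper semicontinuity: if `Xₙ → X` in the Fell topology in a common space `Y`, then the limits
in `τ(Y)` of sequences `aₙ ∈ τ(Xₙ)` belong to `τ(X)`. -/
def UpperSemicontinuous (τ : BCMStructure.{u}) : Prop :=
  ∀ (X : ℕ → BCM.{u}) (X' Y : BCM.{u}) (f : ∀ n, X n ⟶ Y) (f' : X' ⟶ Y), FellConverges f f' →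
    ∀ (a : ∀ n, τ.obj (X n)) (b : τ.obj Y),
      Tendsto (fun n => (τ.map (f n)).toFun (a n)) atTop (𝓝 b) → b ∈ Set.range (τ.map f').toFun

/-- Lower semicontinuity: if `Xₙ → X` in the Fell topology in a common space `Y`, then every
element of `τ(X)` is the limit in `τ(Y)` of elements of `τ(Xₙ)` along some subsequence. -/
def LowerSemicontinuous (τ : BCMStructure.{u}) : Prop :=
  ∀ (X : ℕ → BCM.{u}) (X' Y : BCM.{u}) (f : ∀ n, X n ⟶ Y) (f' : X' ⟶ Y), FellConverges f f' →
    ∀ a : τ.obj X', ∃ φ : ℕ → ℕ, StrictMono φ ∧ ∃ b : ∀ k, τ.obj (X (φ k)),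
      Tendsto (fun k => (τ.map (f (φ k))).toFun (b k)) atTop (𝓝 ((τ.map f').toFun a))

/-- Continuity of a structure. -/
def IsContinuous (τ : BCMStructure.{u}) : Prop :=
  τ.EmbeddingContinuous ∧ τ.UpperSemicontinuous ∧ τ.LowerSemicontinuous

/-- A structure `τ` is Polish with preserved roots if it admits a topological embedding `η` (a
natural transformation, whose components are embeddings) into a structure `τ'` and subfunctors
`S k` of the space-rooted functor of `τ'` such that `τ'` is continuous, separable and has a
complete space-rooted metrization, the `S k` are pullback-stable and open, and
`η_X(τ(X)) = ⋂ₖ Sₖ(X, ρ)`. -/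
def PolishWithPreservedRoots (τ : BCMStructure.{u}) : Prop :=
  ∃ (τ' : BCMStructure.{u}) (η : τ ⟶ τ') (S : ℕ → MTopSubfunctor τ'.spaceRooted),
    (τ'.IsContinuous ∧ τ'.Separable ∧ ∃ m : Metrization τ'.spaceRooted, m.IsComplete) ∧
    (∀ k, (S k).PullbackStable ∧ (S k).Open) ∧
    ∀ X : RootedBCM.{u}, Set.range (η.app X.space).toFun = ⋂ k, (S k).carrier X

theorem PolishWithPreservedRoots.separable {τ : BCMStructure.{u}}
    (h : τ.PolishWithPreservedRoots) : τ.Separable := by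
  obtain ⟨τ', η, -, ⟨-, hs, -⟩, -, -⟩ := h
  intro X
  have := hs X
  let := metrizableSpaceMetric (τ'.obj X)
  have : SecondCountableTopology (τ'.obj X) := UniformSpace.secondCountable_of_separable _
  have := (η.app X).isEmbedding.secondCountableTopology
  infer_instance

end BCMStructure

/-! ### Laws -/

/-- The push-forward of probability measures along a topological embedding of separable metrizable
spaces is a topological embedding for the weak topologies. -/
theorem isEmbedding_probabilityMeasure_map {S T : Type u} [TopologicalSpace S] [MetrizableSpace S]
    [MeasurableSpace S] [BorelSpace S] [TopologicalSpace T] [MetrizableSpace T] [SeparableSpace T]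
    [MeasurableSpace T] [BorelSpace T] {f : S → T} (hf : IsEmbedding f) :
    IsEmbedding (fun μ : ProbabilityMeasure S =>
      μ.map (hf.continuous.measurable.aemeasurable : AEMeasurable f (μ : Measure S))) := by
  have hc := ProbabilityMeasure.continuous_map hf.continuous
  have hind : IsInducing (fun μ : ProbabilityMeasure S =>
      μ.map (hf.continuous.measurable.aemeasurable : AEMeasurable f (μ : Measure S))) := by
    refine isInducing_iff_nhds.2 fun μ => le_antisymm (hc.tendsto μ).le_comap ?_
    refine tendsto_of_forall_isOpen_le_liminf' (L := comap _ _) (μs := id) ?_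
    intro U hU
    obtain ⟨V, hV, rfl⟩ := hf.isOpen_iff.1 hU
    have h := ProbabilityMeasure.le_liminf_measure_open_of_tendsto
      (tendsto_comap (f := fun μ : ProbabilityMeasure S =>
        μ.map (hf.continuous.measurable.aemeasurable : AEMeasurable f (μ : Measure S)))
        (x := 𝓝 (μ.map hf.continuous.measurable.aemeasurable))) hV
    simpa only [ProbabilityMeasure.map_apply' _ _ hV.measurableSet, id_eq] using h
  exact ⟨hind, hind.injective⟩

namespace BCMStructure

/-- The structure of laws on a separable structure `σ`: `X ↦ P(σ(X))`, the space of Borel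
probability measures on `σ(X)` with the weak topology, and `f ↦ (σ_f)_*`. Separability ensures
that `P(σ(X))` is metrizable. -/
noncomputable def laws (σ : BCMStructure.{u}) (hσ : σ.Separable) : BCMStructure.{u} where
  obj X :=
    haveI := hσ X
    MTop.of (ProbabilityMeasure (σ.obj X))
  map {X Y} f :=
    haveI := hσ Y
    ⟨fun μ => μ.map (σ.map f).isEmbedding.continuous.measurable.aemeasurable,
      isEmbedding_probabilityMeasure_map (σ.map f).isEmbedding⟩
  map_id X := by
    apply MTop.Hom.ext
    funext μ
    apply Subtype.ext
    change Measure.map (σ.map (𝟙 X)).toFun (μ : Measure (σ.obj X)) = μ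
    rw [σ.map_id]
    exact Measure.map_id
  map_comp {X Y Z} f g := by
    apply MTop.Hom.ext
    funext μ
    apply Subtype.ext
    change Measure.map (σ.map (f ≫ g)).toFun (μ : Measure (σ.obj X)) =
      Measure.map (σ.map g).toFun (Measure.map (σ.map f).toFun (μ : Measure (σ.obj X)))
    rw [σ.map_comp, Measure.map_map (σ.map g).isEmbedding.continuous.measurable
      (σ.map f).isEmbedding.continuous.measurable]
    rfl

end BCMStructure

/-! Everything rests on the Lévy-Prokhorov distance and the portmanteau theorem.

Stability: a root is put inside the measure by replacing `(μ, x)` with `μ ⊗ δ_x`, a law on `σ(X) ×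
X`. This is an embedding, so the Lévy-Prokhorov metric built on the given metric of `σ(X) × X` pulls
back to `P(σ(X)) × X`. By `levyProkhorovDist_map_le`, a bound `+ δ` on distances between points
passes to laws with the same `δ`, so the distortion function does not change.

Preserved roots: if `σ` sits in the ambient structure `τ` as an intersection of open `S i`, then
`P(σ)` sits in `P(τ)` as the laws with `ν(S i) = 1` for all `i`, that is, `ν(S i) > 1 - 1/(j+1)` for
all `i` and `j`. Each of these countably many conditions is open by the portmanteau theorem.

The properties of `τ` pass to `P(τ)`. Completeness follows from tightness of Cauchy sequences and
Prokhorov's theorem, continuity along embeddings from dominated convergence. For upper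
semicontinuity, a limit law cannot charge a neighbourhood that is eventually avoided; for lower
semicontinuity, laws are approximated by finitely supported ones whose atoms are moved one by one.
-/

open scoped ENNReal

/-! ### Weak convergence of probability measures -/

namespace MeasureTheory

/-- If a pair of maps increases mutual distances by at most `δ`, then the Lévy-Prokhorov distance of
the push-forwards increases by at most `δ`. -/
theorem levyProkhorovDist_map_le {S T M₁ M₂ : Type*} [MeasurableSpace S] [MeasurableSpace T]
    [PseudoMetricSpace M₁] [MeasurableSpace M₁] [OpensMeasurableSpace M₁]
    [PseudoMetricSpace M₂] [MeasurableSpace M₂] [OpensMeasurableSpace M₂]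
    (μ : Measure S) [IsProbabilityMeasure μ] (ν : Measure T) [IsProbabilityMeasure ν]
    {f₁ : S → M₁} {f₂ : S → M₂} {g₁ : T → M₁} {g₂ : T → M₂}
    (hf₁ : Measurable f₁) (hf₂ : Measurable f₂) (hg₁ : Measurable g₁) (hg₂ : Measurable g₂)
    (δ : ℝ≥0) (h : ∀ s t, dist (f₂ s) (g₂ t) ≤ dist (f₁ s) (g₁ t) + δ) :
    levyProkhorovDist (μ.map f₂) (ν.map g₂) ≤ levyProkhorovDist (μ.map f₁) (ν.map g₁) + δ := by
  have := Measure.isProbabilityMeasure_map (μ := μ) hf₁.aemeasurable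
  have := Measure.isProbabilityMeasure_map (μ := μ) hf₂.aemeasurable
  have := Measure.isProbabilityMeasure_map (μ := ν) hg₁.aemeasurable
  have := Measure.isProbabilityMeasure_map (μ := ν) hg₂.aemeasurable
  have h0 : 0 ≤ levyProkhorovDist (μ.map f₁) (ν.map g₁) := ENNReal.toReal_nonneg
  refine levyProkhorovDist_le_of_forall_le _ _ (add_nonneg h0 δ.2) fun ε B hε hB => ?_
  have hr : levyProkhorovDist (μ.map f₁) (ν.map g₁) < ε - δ := by linarith
  have hlt : levyProkhorovEDist (μ.map f₁) (ν.map g₁) < ENNReal.ofReal (ε - δ) :=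
    (ENNReal.lt_ofReal_iff_toReal_lt (levyProkhorovEDist_ne_top _ _)).2 hr
  -- The image `f₁ '' (f₂ ⁻¹' B)` need not be measurable; its closure is, and has the same
  -- thickenings. A point within `ε - δ` of this image through `g₁` is within `ε` of `B` through
  -- `g₂`.
  have key := left_measure_le_of_levyProkhorovEDist_lt hlt
    (isClosed_closure (s := f₁ '' (f₂ ⁻¹' B))).measurableSet
  rw [ENNReal.toReal_ofReal (h0.trans hr.le), Metric.thickening_closure,
    Measure.map_apply hf₁ isClosed_closure.measurableSet,
    Measure.map_apply hg₁ Metric.isOpen_thickening.measurableSet] at key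
  rw [Measure.map_apply hf₂ hB, Measure.map_apply hg₂ Metric.isOpen_thickening.measurableSet]
  refine (measure_mono (t := f₁ ⁻¹' closure (f₁ '' (f₂ ⁻¹' B)))
    fun s hs => subset_closure (Set.mem_image_of_mem f₁ hs)).trans
    (key.trans (add_le_add (measure_mono fun t ht => ?_)
      (ENNReal.ofReal_le_ofReal (sub_le_self _ δ.2))))
  obtain ⟨_, ⟨s, hs, rfl⟩, hst⟩ := Metric.mem_thickening_iff.1 ht
  refine Metric.mem_thickening_iff.2 ⟨f₂ s, hs, ?_⟩
  have := h s t
  rw [dist_comm] at hst ⊢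
  linarith

namespace ProbabilityMeasure

/-- The map `(μ, x) ↦ μ ⊗ δ_x` is a topological embedding. -/
theorem isEmbedding_map_prodMk {S X : Type*} [TopologicalSpace S] [MetrizableSpace S]
    [SecondCountableTopology S] [MeasurableSpace S] [BorelSpace S] [TopologicalSpace X]
    [MetrizableSpace X] [SecondCountableTopology X] [mT : MeasurableSpace (S × X)]
    [BorelSpace (S × X)] :
    IsEmbedding (fun p : ProbabilityMeasure S × X =>
      p.1.map (f := fun s => (s, p.2)) (Continuous.prodMk_left p.2).measurable.aemeasurable) := by
  let : MeasurableSpace X := borel X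
  have : BorelSpace X := ⟨rfl⟩
  -- Second countability makes the product σ-algebra the Borel one, so product measures live on the
  -- given σ-algebra.
  obtain rfl : mT = Prod.instMeasurableSpace :=
    (BorelSpace.measurable_eq (α := S × X)).trans
      (@BorelSpace.measurable_eq (S × X) _ Prod.instMeasurableSpace _).symm
  have heq : (fun p : ProbabilityMeasure S × X =>
      p.1.map (f := fun s => (s, p.2)) (Continuous.prodMk_left p.2).measurable.aemeasurable) =
      fun p => p.1.prod (diracProba p.2) := by
    funext p
    apply Subtype.ext
    exact (Measure.prod_dirac p.2).symm
  rw [heq]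
  -- The two marginals recover `(μ, δ_x)` continuously, and `x ↦ δ_x` is itself an embedding.
  refine IsEmbedding.of_comp (g := fun ν : ProbabilityMeasure (S × X) =>
    (ν.map measurable_fst.aemeasurable, ν.map measurable_snd.aemeasurable)) ?_ ?_ ?_
  · exact continuous_prod.comp
      (continuous_fst.prodMk (continuous_diracProba.comp continuous_snd))
  · exact (continuous_map continuous_fst).prodMk (continuous_map continuous_snd)
  · convert! IsEmbedding.id.prodMap (isEmbedding_diracProba (X := X)) using 1
    funext p
    exact Prod.ext (map_fst_prod _ _) (map_snd_prod _ _)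

/-- Push-forwards along a pointwise convergent sequence of maps converge weakly. -/
theorem tendsto_map_of_forall_tendsto {S T : Type*} [MeasurableSpace S] [TopologicalSpace T]
    [MeasurableSpace T] [OpensMeasurableSpace T] (μ : ProbabilityMeasure S)
    {f : ℕ → S → T} {g : S → T} (hf : ∀ n, AEMeasurable (f n) (μ : Measure S))
    (hg : AEMeasurable g (μ : Measure S)) (h : ∀ s, Tendsto (fun n => f n s) atTop (𝓝 (g s))) :
    Tendsto (fun n => μ.map (hf n)) atTop (𝓝 (μ.map hg)) := by
  rw [tendsto_iff_forall_integral_tendsto]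
  intro φ
  simp only [toMeasure_map]
  rw [integral_map hg φ.continuous.measurable.aestronglyMeasurable]
  simp_rw [fun n => integral_map (hf n) φ.continuous.measurable.aestronglyMeasurable]
  refine tendsto_integral_of_dominated_convergence (fun _ => ‖φ‖)
    (fun n => (φ.continuous.measurable.comp_aemeasurable (hf n)).aestronglyMeasurable)
    (integrable_const _) (fun n => ae_of_all _ fun s => φ.norm_coe_le_norm _)
    (ae_of_all _ fun s => (φ.continuous.tendsto _).comp (h s))

/-- The probability measures giving mass more than `r` to an open set form an open set. -/
theorem isOpen_setOf_lt_measure {S : Type*} [TopologicalSpace S] [MetrizableSpace S]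
    [MeasurableSpace S] [BorelSpace S] {U : Set S} (hU : IsOpen U) (r : ℝ≥0∞) :
    IsOpen {μ : ProbabilityMeasure S | r < (μ : Measure S) U} := by
  refine isOpen_iff_mem_nhds.2 fun μ hμ => ?_
  have h := le_liminf_measure_open_of_tendsto (tendsto_id (x := 𝓝 μ)) hU
  exact eventually_lt_of_lt_liminf (lt_of_lt_of_le hμ h)

/-- Finite unions of basic sets inside `G` increase to `G`, so continuity from below applies. This
reduces the portmanteau conditions for all open sets to countably many. -/
theorem exists_finset_lt_measure_biUnion {S : Type*} [TopologicalSpace S] [MeasurableSpace S]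
    {B : Set (Set S)} (hB : IsTopologicalBasis B) (hBc : B.Countable) (μ : Measure S)
    {G : Set S} (hG : IsOpen G) {c : ℝ≥0∞} (hc : c < μ G) :
    ∃ F : Finset B, (⋃ b ∈ F, (b : Set S)) ⊆ G ∧ c < μ (⋃ b ∈ F, (b : Set S)) := by
  have := hBc.to_subtype
  let V : Set B := {b | (b : Set S) ⊆ G}
  have hV : G = ⋃ F : Finset V, ⋃ b ∈ F, ((b : B) : Set S) := by
    ext x
    simp only [Set.mem_iUnion]
    constructor
    · intro hx
      obtain ⟨b, hb, hxb, hbG⟩ := hB.exists_subset_of_mem_open hx hG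
      exact ⟨{⟨⟨b, hb⟩, hbG⟩}, _, Finset.mem_singleton_self _, hxb⟩
    · rintro ⟨F, b, -, hxb⟩
      exact b.2 hxb
  have hdir : Monotone fun F : Finset V => ⋃ b ∈ F, ((b : B) : Set S) :=
    fun F F' h => Set.biUnion_subset_biUnion_left h
  rw [hV, hdir.measure_iUnion] at hc
  obtain ⟨F, hF⟩ := lt_iSup_iff.1 hc
  have hunion : (⋃ b ∈ F.map (Function.Embedding.subtype _), (b : Set S)) =
      ⋃ b ∈ F, ((b : B) : Set S) := by
    ext x
    simp
  refine ⟨F.map (Function.Embedding.subtype _), ?_, hunion ▸ hF⟩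
  rw [hunion]
  exact Set.iUnion₂_subset fun b _ => b.2

theorem secondCountableTopology {S : Type*} [TopologicalSpace S] [MetrizableSpace S]
    [SecondCountableTopology S] [MeasurableSpace S] [BorelSpace S] :
    SecondCountableTopology (ProbabilityMeasure S) := by
  let B := countableBasis S
  have hBc : B.Countable := countable_countableBasis S
  have hB : IsTopologicalBasis B := isBasis_countableBasis S
  have := hBc.to_subtype
  let A : ℚ × Finset B → Set (ProbabilityMeasure S) := fun p =>
    {μ | (Real.toNNReal p.1 : ℝ≥0∞) < (μ : Measure S) (⋃ b ∈ p.2, (b : Set S))}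
  have hle : (inferInstance : TopologicalSpace (ProbabilityMeasure S)) ≤
      generateFrom (Set.range A) := by
    refine le_generateFrom ?_
    rintro _ ⟨p, rfl⟩
    exact isOpen_setOf_lt_measure (isOpen_biUnion fun b _ => hB.isOpen b.2) _
  have hsc : @SecondCountableTopology _ (generateFrom (Set.range A)) :=
    @SecondCountableTopology.mk _ (generateFrom (Set.range A))
      ⟨_, Set.countable_range A, rfl⟩
  have hge : generateFrom (Set.range A) ≤
      (inferInstance : TopologicalSpace (ProbabilityMeasure S)) := by
    refine le_of_nhds_le_nhds fun μ => ?_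
    -- The portmanteau criterion is applied to the identity along this filter, which must be
    -- countably generated.
    have : (@nhds _ (generateFrom (Set.range A)) μ).IsCountablyGenerated :=
      @FirstCountableTopology.nhds_generated_countable _ (generateFrom (Set.range A))
        (@SecondCountableTopology.to_firstCountableTopology _ (generateFrom (Set.range A)) hsc) μ
    refine tendsto_of_forall_isOpen_le_liminf' (μs := id) fun G hG => ?_
    refine le_of_forall_lt fun c hc => ?_
    obtain ⟨F, hFG, hF⟩ := exists_finset_lt_measure_biUnion hB hBc _ hG hc
    obtain ⟨q, -, hcq, hq⟩ := ENNReal.lt_iff_exists_rat_btwn.1 hF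
    refine hcq.trans_le (le_liminf_of_le (by isBoundedDefault) ?_)
    have hopen : A (q, F) ∈ @nhds _ (generateFrom (Set.range A)) μ :=
      @IsOpen.mem_nhds _ (generateFrom (Set.range A)) μ _
        (isOpen_generateFrom_of_mem ⟨(q, F), rfl⟩) hq
    filter_upwards [hopen] with ν hν
    exact (le_of_lt hν).trans (measure_mono hFG)
  rwa [le_antisymm hge hle] at hsc

/-- A probability measure giving full mass to the measurable range of an embedding is a
push-forward. -/
theorem mem_range_map {S T : Type*} [TopologicalSpace S] [MeasurableSpace S] [BorelSpace S]
    [TopologicalSpace T] [MeasurableSpace T] [BorelSpace T] {f : S → T} (hf : IsEmbedding f)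
    (hr : MeasurableSet (Set.range f)) (ν : ProbabilityMeasure T)
    (hν : (ν : Measure T) (Set.range f)ᶜ = 0) :
    ∃ μ : ProbabilityMeasure S, μ.map hf.continuous.measurable.aemeasurable = ν := by
  have hfm : MeasurableEmbedding f := hf.measurableEmbedding hr
  have h : Measure.map f (Measure.comap f (ν : Measure T)) = ν := by
    rw [hfm.map_comap]
    exact Measure.restrict_eq_self_of_ae_mem (ae_iff.2 hν)
  have hp : IsProbabilityMeasure (Measure.comap f (ν : Measure T)) := by
    constructor
    rw [← Set.preimage_univ (f := f), ← hfm.map_apply, h, measure_univ]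
  exact ⟨⟨_, hp⟩, Subtype.ext h⟩

/-- If the range of an embedding `f` is the intersection of the open sets `A k`, then the
push-forwards along `f` are the probability measures giving full mass to all `A k`. -/
theorem range_map_eq_iInter {S T : Type*} [TopologicalSpace S] [MeasurableSpace S] [BorelSpace S]
    [TopologicalSpace T] [MeasurableSpace T] [BorelSpace T] {f : S → T} (hf : IsEmbedding f)
    {A : ℕ → Set T} (hA : ∀ k, IsOpen (A k)) (hr : Set.range f = ⋂ k, A k) :
    Set.range (fun μ : ProbabilityMeasure S => μ.map hf.continuous.measurable.aemeasurable) =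
      ⋂ k : ℕ, {ν : ProbabilityMeasure T |
        1 - (k.unpair.2 + 1 : ℝ≥0∞)⁻¹ < (ν : Measure T) (A k.unpair.1)} := by
  have hm : ∀ k, MeasurableSet (A k) := fun k => (hA k).measurableSet
  ext ν
  rw [Set.mem_iInter]
  constructor
  · rintro ⟨μ, rfl⟩ k
    change _ < Measure.map f (μ : Measure S) (A k.unpair.1)
    have hpre : f ⁻¹' A k.unpair.1 = Set.univ := Set.eq_univ_of_forall fun a =>
      Set.mem_iInter.1 (hr.subset (Set.mem_range_self a)) _
    rw [Measure.map_apply hf.continuous.measurable (hm _), hpre, measure_univ]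
    exact ENNReal.sub_lt_self ENNReal.one_ne_top one_ne_zero (by simp)
  · intro h
    refine mem_range_map hf (hr ▸ MeasurableSet.iInter hm) ν ?_
    rw [hr, Set.compl_iInter]
    refine measure_iUnion_null fun i => (prob_compl_eq_zero_iff (hm i)).2
      (le_antisymm prob_le_one ?_)
    have hlim : Tendsto (fun j : ℕ => 1 - (j + 1 : ℝ≥0∞)⁻¹) atTop (𝓝 (1 - 0)) := by
      refine ENNReal.Tendsto.sub tendsto_const_nhds ?_ (.inl ENNReal.one_ne_top)
      exact_mod_cast ENNReal.tendsto_inv_nat_nhds_zero.comp (tendsto_add_atTop_nat 1)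
    rw [tsub_zero] at hlim
    refine le_of_tendsto' hlim fun j => ?_
    have := h (Nat.pair i j)
    rw [Nat.unpair_pair] at this
    exact le_of_lt this

/-- A weak limit of measures carried by sets that eventually avoid a neighbourhood of every point
outside `A` is carried by `A`. -/
theorem measure_compl_eq_zero_of_tendsto {T : Type*} [TopologicalSpace T] [MetrizableSpace T]
    [SecondCountableTopology T] [MeasurableSpace T] [BorelSpace T]
    {ν : ℕ → ProbabilityMeasure T} {ν' : ProbabilityMeasure T} (h : Tendsto ν atTop (𝓝 ν'))
    {A : Set T} (hA : ∀ y ∉ A, ∃ U, IsOpen U ∧ y ∈ U ∧ ∀ᶠ n in atTop, (ν n : Measure T) U = 0) :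
    (ν' : Measure T) Aᶜ = 0 := by
  -- Second countability turns local nullity into nullity.
  refine measure_null_of_locally_null _ fun y hy => ?_
  obtain ⟨U, hU, hyU, hn⟩ := hA y hy
  refine ⟨U, mem_nhdsWithin_of_mem_nhds (hU.mem_nhds hyU), ?_⟩
  have hlim := le_liminf_measure_open_of_tendsto h hU
  rw [liminf_congr hn] at hlim
  simpa using hlim

end ProbabilityMeasure

/-- A Lévy-Prokhorov Cauchy sequence in a complete space is tight. -/
theorem isTightMeasureSet_range_of_cauchySeq {S : Type*} [MetricSpace S] [CompleteSpace S]
    [SeparableSpace S] [MeasurableSpace S] [BorelSpace S]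
    {μ : ℕ → LevyProkhorov (ProbabilityMeasure S)} (hμ : CauchySeq μ) :
    IsTightMeasureSet (Set.range fun n => ((μ n).toMeasure : Measure S)) := by
  have : SecondCountableTopology S := UniformSpace.secondCountable_of_separable S
  -- One compact set serves all `n`: up to `N` each law is tight by itself, and later laws are
  -- `c`-close to `μ N`. One `c` is the mass lost by `μ N`, the other the Lévy-Prokhorov error.
  have step : ∀ c : ℝ, 0 < c → ∃ K : Set S, IsCompact K ∧
      ∀ n, ((μ n).toMeasure : Measure S) (Metric.cthickening c K)ᶜ ≤ 2 * ENNReal.ofReal c := by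
    intro c hc
    obtain ⟨N, hN⟩ := Metric.cauchySeq_iff'.1 hμ c hc
    have hsingle : ∀ n, ∃ K : Set S, IsCompact K ∧
        ((μ n).toMeasure : Measure S) Kᶜ ≤ ENNReal.ofReal c := fun n => by
      obtain ⟨K, hK, h⟩ := isTightMeasureSet_iff_exists_isCompact_measure_compl_le.1
        (isTightMeasureSet_singleton (μ := ((μ n).toMeasure : Measure S))) _
        (ENNReal.ofReal_pos.2 hc)
      exact ⟨K, hK, h _ rfl⟩
    choose K hK hKμ using hsingle
    refine ⟨⋃ n ∈ Set.Iic N, K n, (Set.finite_Iic N).isCompact_biUnion fun n _ => hK n,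
      fun n => ?_⟩
    rcases le_total n N with hn | hn
    · refine (measure_mono (Set.compl_subset_compl.2 ?_)).trans
        ((hKμ n).trans (le_mul_of_one_le_left' one_le_two))
      exact (Set.subset_biUnion_of_mem (u := K) (show n ∈ Set.Iic N from hn)).trans
        (Metric.self_subset_cthickening _)
    · have hlt : levyProkhorovEDist ((μ n).toMeasure : Measure S) (μ N).toMeasure <
          ENNReal.ofReal c :=
        (ENNReal.lt_ofReal_iff_toReal_lt (levyProkhorovEDist_ne_top _ _)).2 (hN n hn)
      have hsub : Metric.thickening c (Metric.cthickening c (⋃ n ∈ Set.Iic N, K n))ᶜ ⊆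
          (K N)ᶜ := by
        intro y hy hyK
        obtain ⟨z, hz, hyz⟩ := Metric.mem_thickening_iff.1 hy
        refine hz (Metric.thickening_subset_cthickening _ _
          (Metric.mem_thickening_iff.2 ⟨y, ?_, by rwa [dist_comm]⟩))
        exact Set.subset_biUnion_of_mem (u := K) (Set.mem_Iic.2 le_rfl) hyK
      have h := left_measure_le_of_levyProkhorovEDist_lt hlt
        (Metric.isClosed_cthickening (δ := c) (E := ⋃ n ∈ Set.Iic N, K n)).measurableSet.compl
      rw [ENNReal.toReal_ofReal hc.le] at h
      rw [two_mul]
      exact h.trans (add_le_add ((measure_mono hsub).trans (hKμ N)) le_rfl)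
  rw [isTightMeasureSet_iff_exists_isCompact_measure_compl_le]
  intro ε hε
  -- The scales `c m` tend to `0`, for total boundedness, while the lost masses `2 * c m` sum to at
  -- most `ε`.
  obtain ⟨ε', hε', hsum⟩ := ENNReal.exists_pos_sum_of_countable hε.ne' ℕ
  have hc : ∀ m : ℕ, ∃ c : ℝ, 0 < c ∧ c < 1 / (m + 1) ∧ 2 * ENNReal.ofReal c ≤ ε' m := by
    intro m
    have hm : (0 : ℝ) < 1 / (m + 1) := Nat.one_div_pos_of_nat
    have hp : (0 : ℝ) < ε' m := hε' m
    refine ⟨min (1 / (m + 1) / 2) (ε' m / 2), by positivity,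
      (min_le_left _ _).trans_lt (half_lt_self hm), ?_⟩
    calc 2 * ENNReal.ofReal (min (1 / (m + 1) / 2) (ε' m / 2))
        ≤ 2 * ENNReal.ofReal (ε' m / 2) := by gcongr; exact min_le_right _ _
      _ = ENNReal.ofReal (2 * (ε' m / 2)) := by
        rw [ENNReal.ofReal_mul zero_le_two, ENNReal.ofReal_ofNat]
      _ = ε' m := by rw [mul_div_cancel₀ _ two_ne_zero, ENNReal.ofReal_coe_nnreal]
  choose c hc0 hcm hcε using hc
  choose K hK hKμ using fun m => step (c m) (hc0 m)
  refine ⟨⋂ m, Metric.cthickening (c m) (K m), ?_, ?_⟩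
  · refine TotallyBounded.isCompact_of_isClosed ?_
      (isClosed_iInter fun m => Metric.isClosed_cthickening)
    refine Metric.totallyBounded_iff.2 fun r hr => ?_
    obtain ⟨m, hm⟩ := exists_nat_one_div_lt (half_pos hr)
    obtain ⟨t, ht, hKt⟩ := Metric.totallyBounded_iff.1 (hK m).totallyBounded (r / 2) (half_pos hr)
    refine ⟨t, ht, fun x hx => ?_⟩
    have hx' := Metric.cthickening_subset_thickening' (half_pos hr) ((hcm m).trans hm) (K m)
      (Set.mem_iInter.1 hx m)
    obtain ⟨z, hz, hxz⟩ := Metric.mem_thickening_iff.1 hx'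
    obtain ⟨y, hy, hzy⟩ := Set.mem_iUnion₂.1 (hKt hz)
    refine Set.mem_iUnion₂.2 ⟨y, hy, ?_⟩
    have := dist_triangle x z y
    rw [Metric.mem_ball] at hzy ⊢
    linarith
  · rintro _ ⟨n, rfl⟩
    rw [Set.compl_iInter]
    exact (measure_iUnion_le _).trans
      ((ENNReal.tsum_le_tsum fun m => (hKμ m n).trans (hcε m)).trans hsum.le)

/-- Prokhorov's theorem gives a tight Cauchy sequence a convergent subsequence, and then the whole
sequence converges. -/
instance LevyProkhorov.completeSpace_probabilityMeasure {S : Type*} [MetricSpace S]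
    [CompleteSpace S] [SeparableSpace S] [MeasurableSpace S] [BorelSpace S] :
    CompleteSpace (LevyProkhorov (ProbabilityMeasure S)) := by
  have : SecondCountableTopology S := UniformSpace.secondCountable_of_separable S
  refine UniformSpace.complete_of_cauchySeq_tendsto fun μ hμ => ?_
  have hcomp : IsCompact (closure (Set.range fun n => (μ n).toMeasure)) := by
    refine isCompact_closure_of_isTightMeasureSet
      ((isTightMeasureSet_range_of_cauchySeq hμ).subset ?_)
    rintro _ ⟨_, ⟨n, rfl⟩, rfl⟩
    exact ⟨n, rfl⟩
  obtain ⟨ν, -, φ, hφ, hν⟩ := hcomp.isSeqCompact fun n => subset_closure (Set.mem_range_self n)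
  refine ⟨LevyProkhorov.ofMeasure ν, tendsto_nhds_of_cauchySeq_of_subseq hμ hφ.tendsto_atTop ?_⟩
  exact (LevyProkhorov.continuous_ofMeasure_probabilityMeasure.tendsto ν).comp hν

/-! ### Metrics on spaces of probability measures -/

namespace ProbabilityMeasure

/-- The Lévy-Prokhorov metric on probability measures that is associated with a metric inducing the
given topology. -/
noncomputable abbrev prokhorovMetric {S : Type*} [t : TopologicalSpace S] [MeasurableSpace S]
    [BorelSpace S] (m : MetricSpace S) (h : m.toUniformSpace.toTopologicalSpace = t) :
    MetricSpace (ProbabilityMeasure S) :=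
  letI := m.replaceTopology h.symm
  MetricSpace.induced LevyProkhorov.ofMeasure LevyProkhorov.toMeasureEquiv.symm.injective
    inferInstance

section

variable {S : Type*} [t : TopologicalSpace S] [MeasurableSpace S] [BorelSpace S]
  (m : MetricSpace S) (h : m.toUniformSpace.toTopologicalSpace = t)

theorem prokhorovMetric_topology_eq [SeparableSpace S] :
    (prokhorovMetric m h).toUniformSpace.toTopologicalSpace =
      (inferInstance : TopologicalSpace (ProbabilityMeasure S)) := by
  subst h
  exact (LevyProkhorov.probabilityMeasureHomeomorph (Ω := S)).isInducing.eq_induced.symm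

theorem completeSpace_prokhorovMetric [SeparableSpace S] (hc : @CompleteSpace S m.toUniformSpace) :
    @CompleteSpace (ProbabilityMeasure S) (prokhorovMetric m h).toUniformSpace := by
  subst h
  let := prokhorovMetric m rfl
  exact (IsUniformInducing.completeSpace_congr
    (f := (LevyProkhorov.ofMeasure : ProbabilityMeasure S → LevyProkhorov (ProbabilityMeasure S)))
    ⟨rfl⟩ LevyProkhorov.toMeasureEquiv.symm.surjective).2 inferInstance

theorem prokhorovMetric_dist_map {T : Type*} [t' : TopologicalSpace T] [MeasurableSpace T]
    [BorelSpace T] (m' : MetricSpace T) (h' : m'.toUniformSpace.toTopologicalSpace = t')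
    {f : S → T} (hf : Continuous f) (hd : ∀ a b, m'.dist (f a) (f b) = m.dist a b)
    (μ ν : ProbabilityMeasure S) :
    (prokhorovMetric m' h').dist (μ.map hf.measurable.aemeasurable)
      (ν.map hf.measurable.aemeasurable) = (prokhorovMetric m h).dist μ ν := by
  subst h h'
  change levyProkhorovDist (Measure.map f (μ : Measure S)) (Measure.map f (ν : Measure S)) =
    levyProkhorovDist (μ : Measure S) ν
  -- Equality is the comparison bound with `δ = 0`, used from the identity to `f` and back.
  have h₁ := levyProkhorovDist_map_le (μ : Measure S) (ν : Measure S) measurable_id hf.measurable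
    measurable_id hf.measurable 0 fun a b => by simpa using (hd a b).le
  have h₂ := levyProkhorovDist_map_le (μ : Measure S) (ν : Measure S) hf.measurable measurable_id
    hf.measurable measurable_id 0 fun a b => by simpa using (hd a b).ge
  simp only [Measure.map_id, NNReal.coe_zero, add_zero] at h₁ h₂
  exact le_antisymm h₁ h₂

end

/-! ### Metrics on pairs of a law and a point -/

section

variable {S X : Type*} [TopologicalSpace S] [MetrizableSpace S] [SeparableSpace S]
  [MeasurableSpace S] [BorelSpace S] [TopologicalSpace X] [MetrizableSpace X]
  [SecondCountableTopology X]

/-- The metric on `P(S) × X` for which `(μ, x) ↦ μ ⊗ δ_x` is an isometry to `P(S × X)` with the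
Lévy-Prokhorov metric. -/
noncomputable abbrev prokhorovPairMetric (m : MetricSpace (S × X))
    (h : m.toUniformSpace.toTopologicalSpace = instTopologicalSpaceProd) :
    MetricSpace (ProbabilityMeasure S × X) :=
  haveI : SecondCountableTopology S :=
    let := metrizableSpaceMetric S
    UniformSpace.secondCountable_of_separable S
  letI : MeasurableSpace (S × X) := borel _
  haveI : BorelSpace (S × X) := ⟨rfl⟩
  MetricSpace.induced _ isEmbedding_map_prodMk.injective (prokhorovMetric m h)

theorem prokhorovPairMetric_topology_eq (m : MetricSpace (S × X))
    (h : m.toUniformSpace.toTopologicalSpace = instTopologicalSpaceProd) :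
    (prokhorovPairMetric m h).toUniformSpace.toTopologicalSpace = instTopologicalSpaceProd := by
  have : SecondCountableTopology S :=
    let := metrizableSpaceMetric S
    UniformSpace.secondCountable_of_separable S
  let : MeasurableSpace (S × X) := borel _
  have : BorelSpace (S × X) := ⟨rfl⟩
  exact (congrArg (induced _) (prokhorovMetric_topology_eq m h)).trans
    (isEmbedding_map_prodMk (S := S) (X := X)).eq_induced.symm

/-- With the points `x` and `y` fixed, each law involved is a push-forward of `μ` or `ν` along a map
such as `s ↦ (F s, f x)`, so `levyProkhorovDist_map_le` applies. -/
theorem prokhorovPairMetric_dist_map_le {S' X' T Y T' Y' : Type*}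
    [TopologicalSpace S'] [MetrizableSpace S'] [SeparableSpace S'] [MeasurableSpace S']
    [BorelSpace S'] [TopologicalSpace X'] [MetrizableSpace X'] [SecondCountableTopology X']
    [TopologicalSpace T] [MeasurableSpace T] [BorelSpace T]
    [TopologicalSpace T'] [MeasurableSpace T'] [BorelSpace T']
    (m : MetricSpace (S × X)) (h : m.toUniformSpace.toTopologicalSpace = instTopologicalSpaceProd)
    (m' : MetricSpace (S' × X'))
    (h' : m'.toUniformSpace.toTopologicalSpace = instTopologicalSpaceProd)
    {F : T → S} (hF : Continuous F) {F' : T → S'} (hF' : Continuous F')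
    {G : T' → S} (hG : Continuous G) {G' : T' → S'} (hG' : Continuous G')
    (f : Y → X) (f' : Y → X') (g : Y' → X) (g' : Y' → X') (δ : ℝ≥0)
    (hd : ∀ (a : T × Y) (b : T' × Y'), m'.dist (Prod.map F' f' a) (Prod.map G' g' b) ≤
      m.dist (Prod.map F f a) (Prod.map G g b) + δ)
    (p : ProbabilityMeasure T × Y) (q : ProbabilityMeasure T' × Y') :
    (prokhorovPairMetric m' h').dist (p.1.map hF'.measurable.aemeasurable, f' p.2)
        (q.1.map hG'.measurable.aemeasurable, g' q.2) ≤
      (prokhorovPairMetric m h).dist (p.1.map hF.measurable.aemeasurable, f p.2)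
        (q.1.map hG.measurable.aemeasurable, g q.2) + δ := by
  obtain ⟨μ, x⟩ := p
  obtain ⟨ν, y⟩ := q
  let : MeasurableSpace (S × X) := borel _
  have : BorelSpace (S × X) := ⟨rfl⟩
  let : MeasurableSpace (S' × X') := borel _
  have : BorelSpace (S' × X') := ⟨rfl⟩
  let i₁ := m.replaceTopology h.symm
  let i₂ := m'.replaceTopology h'.symm
  change levyProkhorovDist (Measure.map (fun s => (s, f' x)) (Measure.map F' (μ : Measure T)))
      (Measure.map (fun s => (s, g' y)) (Measure.map G' (ν : Measure T'))) ≤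
    levyProkhorovDist (Measure.map (fun s => (s, f x)) (Measure.map F (μ : Measure T)))
      (Measure.map (fun s => (s, g y)) (Measure.map G (ν : Measure T'))) + δ
  have mk {z : X} : Measurable fun s : S => (s, z) := (Continuous.prodMk_left z).measurable
  have mk' {z : X'} : Measurable fun s : S' => (s, z) := (Continuous.prodMk_left z).measurable
  rw [Measure.map_map mk' hF'.measurable, Measure.map_map mk' hG'.measurable,
    Measure.map_map mk hF.measurable, Measure.map_map mk hG.measurable]
  exact levyProkhorovDist_map_le (μ : Measure T) (ν : Measure T') (mk.comp hF.measurable)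
    (mk'.comp hF'.measurable) (mk.comp hG.measurable) (mk'.comp hG'.measurable) δ
    fun s t => hd (s, x) (t, y)

theorem prokhorovPairMetric_dist_map {S' X' : Type*}
    [TopologicalSpace S'] [MetrizableSpace S'] [SeparableSpace S'] [MeasurableSpace S']
    [BorelSpace S'] [TopologicalSpace X'] [MetrizableSpace X'] [SecondCountableTopology X']
    (m : MetricSpace (S × X)) (h : m.toUniformSpace.toTopologicalSpace = instTopologicalSpaceProd)
    (m' : MetricSpace (S' × X'))
    (h' : m'.toUniformSpace.toTopologicalSpace = instTopologicalSpaceProd)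
    {F : S → S'} (hF : Continuous F) (f : X → X')
    (hd : ∀ a b : S × X, m'.dist (Prod.map F f a) (Prod.map F f b) = m.dist a b)
    (p q : ProbabilityMeasure S × X) :
    (prokhorovPairMetric m' h').dist (p.1.map hF.measurable.aemeasurable, f p.2)
        (q.1.map hF.measurable.aemeasurable, f q.2) = (prokhorovPairMetric m h).dist p q := by
  have hid (μ : ProbabilityMeasure S) : μ.map (continuous_id.measurable.aemeasurable) = μ :=
    Subtype.ext Measure.map_id
  have h₁ := prokhorovPairMetric_dist_map_le m h m' h' continuous_id hF continuous_id hF id f id f 0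
    (fun a b => by simpa using (hd a b).le) p q
  have h₂ := prokhorovPairMetric_dist_map_le m' h' m h hF continuous_id hF continuous_id f id f id 0
    (fun a b => by simpa using (hd a b).ge) p q
  simp only [hid, id, NNReal.coe_zero, add_zero] at h₁ h₂
  exact le_antisymm h₁ h₂

end

end ProbabilityMeasure

end MeasureTheory

/-! ### Structures of laws -/

theorem FellConverges.comp_tendsto {X : ℕ → BCM.{u}} {X' Y : BCM.{u}} {f : ∀ n, X n ⟶ Y}
    {f' : X' ⟶ Y} (h : FellConverges f f') {φ : ℕ → ℕ} (hφ : Tendsto φ atTop atTop) :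
    FellConverges (fun n => f (φ n)) f' :=
  Tendsto.comp h hφ

theorem FellConverges.const {X Y : BCM.{u}} (f : X ⟶ Y) : FellConverges (fun _ => f) f :=
  @tendsto_const_nhds (Closeds Y) (x := BCM.Hom.closedRange f) (f := atTop) (_) _

namespace BCMStructure

variable {τ : BCMStructure.{u}}

/-- If `τ` is upper semicontinuous, then the images of `τ(Xₙ)` eventually avoid a neighbourhood of
every point outside the image of `τ(X)`. -/
theorem UpperSemicontinuous.exists_isOpen_disjoint (hτ : τ.UpperSemicontinuous)
    {X : ℕ → BCM.{u}} {X' Y : BCM.{u}} {f : ∀ n, X n ⟶ Y} {f' : X' ⟶ Y} (h : FellConverges f f')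
    {y : τ.obj Y} (hy : y ∉ Set.range (τ.map f').toFun) :
    ∃ U, IsOpen U ∧ y ∈ U ∧ ∀ᶠ n in atTop, ∀ a, (τ.map (f n)).toFun a ∉ U := by
  by_contra! hU
  obtain ⟨V, hV⟩ := (𝓝 y).exists_antitone_basis
  have hfreq : ∀ k, ∃ᶠ n in atTop, ∃ a, (τ.map (f n)).toFun a ∈ V k := fun k => by
    have := hU (interior (V k)) isOpen_interior
      (mem_interior_iff_mem_nhds.2 (hV.1.mem_of_mem trivial))
    exact this.mono fun n ⟨a, ha⟩ => ⟨a, interior_subset ha⟩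
  -- Otherwise a subsequence picks elements in shrinking neighbourhoods of `y`; they converge to
  -- `y`, against upper semicontinuity.
  obtain ⟨φ, hφ, ha⟩ := extraction_forall_of_frequently hfreq
  choose a ha using ha
  exact hy (hτ _ _ _ _ _ (h.comp_tendsto hφ.tendsto_atTop) a y (hV.tendsto ha))

/-- This is upper semicontinuity along the constant sequence `f`. -/
theorem UpperSemicontinuous.isClosed_range (hτ : τ.UpperSemicontinuous) {X Y : BCM.{u}}
    (f : X ⟶ Y) : IsClosed (Set.range (τ.map f).toFun) := by
  refine isOpen_compl_iff.1 (isOpen_iff_forall_mem_open.2 fun y hy => ?_)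
  obtain ⟨U, hU, hyU, hn⟩ := hτ.exists_isOpen_disjoint (.const f) hy
  obtain ⟨n, hn⟩ := hn.exists
  refine ⟨U, ?_, hU, hyU⟩
  rintro _ hz ⟨a, rfl⟩
  exact hn a hz

/-- If `τ` is lower semicontinuous, then the elements of `τ(X)` are limits of elements of the
`τ(Xₙ)`. -/
theorem LowerSemicontinuous.exists_tendsto (hτ : τ.LowerSemicontinuous)
    (hne : ∀ X : BCM.{u}, Nonempty (τ.obj X))
    {X : ℕ → BCM.{u}} {X' Y : BCM.{u}} {f : ∀ n, X n ⟶ Y} {f' : X' ⟶ Y} (h : FellConverges f f')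
    (a : τ.obj X') :
    ∃ b : ∀ n, τ.obj (X n),
      Tendsto (fun n => (τ.map (f n)).toFun (b n)) atTop (𝓝 ((τ.map f').toFun a)) := by
  let := metrizableSpaceMetric (τ.obj Y)
  let y := (τ.map f').toFun a
  let r : ℕ → ℝ := fun n => Metric.infDist y (Set.range (τ.map (f n)).toFun)
  -- Lower semicontinuity applied to each subsequence gives a further one along which `r` tends to
  -- `0`; this upgrades subsequential approximation to the full sequence.
  have hr : Tendsto r atTop (𝓝 0) := by
    refine tendsto_of_subseq_tendsto fun ns hns => ?_
    obtain ⟨φ, -, b, hb⟩ := hτ _ _ _ _ _ (h.comp_tendsto hns) a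
    refine ⟨φ, squeeze_zero (fun _ => Metric.infDist_nonneg)
      (fun n => Metric.infDist_le_dist_of_mem (Set.mem_range_self (b n))) ?_⟩
    simpa [dist_comm] using tendsto_iff_dist_tendsto_zero.1 hb
  have hb : ∀ n, ∃ b, dist y ((τ.map (f n)).toFun b) < r n + 1 / (n + 1) := fun n => by
    have := hne (X n)
    obtain ⟨_, ⟨b, rfl⟩, hb⟩ := (Metric.infDist_lt_iff (Set.range_nonempty _)).1
      (lt_add_of_pos_right (r n) (Nat.one_div_pos_of_nat (n := n)))
    exact ⟨b, hb⟩
  choose b hb using hb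
  refine ⟨b, tendsto_iff_dist_tendsto_zero.2 (squeeze_zero (fun _ => dist_nonneg)
    (fun n => (dist_comm _ _).trans_le (hb n).le) ?_)⟩
  simpa using hr.add tendsto_one_div_add_atTop_nhds_zero_nat

theorem secondCountableTopology_obj (hτ : τ.Separable) (X : BCM.{u}) :
    SecondCountableTopology (τ.obj X) :=
  let := metrizableSpaceMetric (τ.obj X)
  have := hτ X
  UniformSpace.secondCountable_of_separable _

theorem measurable_map {X Y : BCM.{u}} (f : X ⟶ Y) : Measurable (τ.map f).toFun :=
  (τ.map f).isEmbedding.continuous.measurable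

theorem laws_separable (hs : τ.Separable) : (τ.laws hs).Separable := fun X => by
  have := secondCountableTopology_obj hs X
  have : SecondCountableTopology (ProbabilityMeasure (τ.obj X)) :=
    ProbabilityMeasure.secondCountableTopology
  exact inferInstanceAs (SeparableSpace (ProbabilityMeasure (τ.obj X)))

theorem EmbeddingContinuous.laws (hτ : τ.EmbeddingContinuous) (hs : τ.Separable) :
    (τ.laws hs).EmbeddingContinuous := fun X Y f f' hf μ =>
  ProbabilityMeasure.tendsto_map_of_forall_tendsto (S := τ.obj X) (T := τ.obj Y) μ
    (fun n => (measurable_map (f n)).aemeasurable) (measurable_map f').aemeasurable (hτ X Y f f' hf)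

theorem UpperSemicontinuous.laws (hτ : τ.UpperSemicontinuous) (hs : τ.Separable) :
    (τ.laws hs).UpperSemicontinuous := by
  intro X X' Y f f' hf (μ : ∀ n, ProbabilityMeasure (τ.obj (X n))) ν hν
  have := secondCountableTopology_obj hs Y
  refine ProbabilityMeasure.mem_range_map (τ.map f').isEmbedding
    (hτ.isClosed_range f').measurableSet ν ?_
  refine ProbabilityMeasure.measure_compl_eq_zero_of_tendsto hν fun y hy => ?_
  obtain ⟨U, hU, hyU, hn⟩ := hτ.exists_isOpen_disjoint hf hy
  refine ⟨U, hU, hyU, hn.mono fun n hn => ?_⟩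
  change Measure.map (τ.map (f n)).toFun (μ n : Measure (τ.obj (X n))) U = 0
  rw [Measure.map_apply (measurable_map _) hU.measurableSet,
    Set.eq_empty_of_forall_notMem (s := (τ.map (f n)).toFun ⁻¹' U) hn, measure_empty]

/-- Round `μ` to finitely many points of a dense sequence, move each atom into `τ(Xₙ)`, and take a
diagonal sequence. -/
theorem LowerSemicontinuous.laws (hτ : τ.LowerSemicontinuous) (hs : τ.Separable)
    (hne : ∀ X : BCM.{u}, Nonempty (τ.obj X)) : (τ.laws hs).LowerSemicontinuous := by
  intro X X' Y f f' hf (μ : ProbabilityMeasure (τ.obj X'))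
  have := hs X'
  have := hs Y
  have := hne X'
  let := metrizableSpaceMetric (τ.obj X')
  let e := denseSeq (τ.obj X')
  choose b hb using fun j => hτ.exists_tendsto hne hf (e j)
  -- `ind k` is the law of the index of the point nearest to a `μ`-random element among `e 0, …, e
  -- k`. Working on `ℕ` makes every choice of atoms measurable.
  let ind : ℕ → ProbabilityMeasure ℕ := fun k =>
    μ.map (SimpleFunc.nearestPtInd e k).measurable.aemeasurable
  let ν : ∀ k n, ProbabilityMeasure (τ.obj (X n)) := fun k n =>
    (ind k).map (f := fun j => b j n) (measurable_from_nat.aemeasurable)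
  let push {Z : BCM.{u}} (g : Z ⟶ Y) (ρ : ProbabilityMeasure (τ.obj Z)) :
    ProbabilityMeasure (τ.obj Y) := ρ.map (measurable_map g).aemeasurable
  let μ' : ℕ → ProbabilityMeasure (τ.obj Y) := fun k =>
    (ind k).map (f := fun j => (τ.map f').toFun (e j)) measurable_from_nat.aemeasurable
  have h₁ : ∀ k, Tendsto (fun n => push (f n) (ν k n)) atTop (𝓝 (μ' k)) := fun k => by
    have heq : ∀ n, push (f n) (ν k n) = (ind k).map
        (f := fun j => (τ.map (f n)).toFun (b j n)) measurable_from_nat.aemeasurable := fun n =>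
      Subtype.ext (Measure.map_map (measurable_map (f n)) measurable_from_nat)
    exact (ProbabilityMeasure.tendsto_map_of_forall_tendsto _ _ _ hb).congr fun n => (heq n).symm
  have h₂ : Tendsto μ' atTop (𝓝 (push f' μ)) := by
    have heq : ∀ k, μ' k = μ.map (f := fun a => (τ.map f').toFun (SimpleFunc.nearestPt e k a))
        ((measurable_map f').comp (SimpleFunc.nearestPt e k).measurable).aemeasurable := fun k =>
      Subtype.ext (Measure.map_map measurable_from_nat (SimpleFunc.nearestPtInd e k).measurable)
    refine (ProbabilityMeasure.tendsto_map_of_forall_tendsto _ _ _ fun a => ?_).congr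
      fun k => (heq k).symm
    exact ((τ.map f').isEmbedding.continuous.tendsto a).comp
      (SimpleFunc.tendsto_nearestPt (denseRange_denseSeq (τ.obj X') a))
  let := metrizableSpaceMetric (ProbabilityMeasure (τ.obj Y))
  -- Diagonal choice: `φ k` is so large that the moved atoms give a law within `1/(k+1)` of `μ' k`.
  obtain ⟨φ, hφ, hd⟩ := extraction_forall_of_eventually fun k =>
    (h₁ k).eventually (Metric.ball_mem_nhds _ (Nat.one_div_pos_of_nat (α := ℝ) (n := k)))
  refine ⟨φ, hφ, fun k => ν k (φ k), ?_⟩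
  change Tendsto (fun k => push (f (φ k)) (ν k (φ k))) atTop (𝓝 (push f' μ))
  refine (tendsto_iff_of_dist (squeeze_zero (fun _ => dist_nonneg) (fun k => ?_)
    (tendsto_one_div_add_atTop_nhds_zero_nat (𝕜 := ℝ)))).1 h₂
  exact (dist_comm _ _).trans_le (hd k).le

theorem IsContinuous.laws (hτ : τ.IsContinuous) (hs : τ.Separable)
    (hne : ∀ X : BCM.{u}, Nonempty (τ.obj X)) : (τ.laws hs).IsContinuous :=
  ⟨hτ.1.laws hs, hτ.2.1.laws hs, hτ.2.2.laws hs hne⟩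

end BCMStructure

/-- The Lévy-Prokhorov metrization of the space-rooted structure of laws. -/
noncomputable def Metrization.laws {τ : BCMStructure.{u}} (m : Metrization τ.spaceRooted)
    (hs : τ.Separable) : Metrization (τ.laws hs).spaceRooted where
  metric X := ProbabilityMeasure.prokhorovMetric (S := τ.spaceRooted.obj X) (m.metric X) (m.topology_eq X)
  nonempty X := by
    obtain ⟨a⟩ := m.nonempty X
    exact ⟨diracProba (X := τ.spaceRooted.obj X) a⟩
  topology_eq X :=
    have : SeparableSpace (τ.spaceRooted.obj X) := hs X.space
    ProbabilityMeasure.prokhorovMetric_topology_eq (S := τ.spaceRooted.obj X) (m.metric X)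
      (m.topology_eq X)
  dist_map {X Y} f μ ν :=
    ProbabilityMeasure.prokhorovMetric_dist_map (S := τ.spaceRooted.obj X) (T := τ.spaceRooted.obj Y)
      (m.metric X) (m.topology_eq X) (m.metric Y) (m.topology_eq Y)
      (τ.spaceRooted.map f).isEmbedding.continuous (m.dist_map f) μ ν

theorem Metrization.IsComplete.laws {τ : BCMStructure.{u}} {m : Metrization τ.spaceRooted}
    (hm : m.IsComplete) (hs : τ.Separable) : (m.laws hs).IsComplete := fun X =>
  have : SeparableSpace (τ.spaceRooted.obj X) := hs X.space
  ProbabilityMeasure.completeSpace_prokhorovMetric (S := τ.spaceRooted.obj X) (m.metric X)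
    (m.topology_eq X) (hm X)

/-- The element-rooted metrization of the structure of laws that is induced by the Lévy-Prokhorov
metric on the laws on `τ(X) × X`. -/
noncomputable def Metrization.lawsElementRooted {τ : BCMStructure.{u}}
    (m : Metrization τ.elementRooted) (hs : τ.Separable) :
    Metrization (τ.laws hs).elementRooted where
  metric X :=
    have := hs X
    ProbabilityMeasure.prokhorovPairMetric (S := τ.obj X) (X := X) (m.metric X) (m.topology_eq X)
  nonempty X := by
    obtain ⟨a, x⟩ := m.nonempty X
    exact ⟨diracProba (X := τ.obj X) a, x⟩
  topology_eq X :=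
    have := hs X
    ProbabilityMeasure.prokhorovPairMetric_topology_eq (S := τ.obj X) (X := X) (m.metric X)
      (m.topology_eq X)
  dist_map {X Y} f p q :=
    have := hs X
    have := hs Y
    ProbabilityMeasure.prokhorovPairMetric_dist_map (S := τ.obj X) (S' := τ.obj Y) (X := X)
      (X' := Y) (m.metric X) (m.topology_eq X) (m.metric Y) (m.topology_eq Y)
      (τ.map f).isEmbedding.continuous f.toFun (m.dist_map f) p q

theorem Metrization.IsStable.lawsElementRooted {τ : BCMStructure.{u}}
    {m : Metrization τ.elementRooted} (hm : m.IsStable) (hs : τ.Separable) :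
    (m.lawsElementRooted hs).IsStable := by
  obtain ⟨δ, hδ, hδ0, h⟩ := hm
  refine ⟨δ, hδ, hδ0, fun X Y M₁ M₂ f₁ f₂ g₁ g₂ ε hε p q => ?_⟩
  have := hs M₁
  have := hs M₂
  exact ProbabilityMeasure.prokhorovPairMetric_dist_map_le (S := τ.obj M₁) (S' := τ.obj M₂)
    (T := τ.obj X) (T' := τ.obj Y) (X := M₁) (X' := M₂) (m.metric M₁) (m.topology_eq M₁)
    (m.metric M₂) (m.topology_eq M₂) (τ.map f₁).isEmbedding.continuous
    (τ.map f₂).isEmbedding.continuous (τ.map g₁).isEmbedding.continuous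
    (τ.map g₂).isEmbedding.continuous f₁.toFun f₂.toFun g₁.toFun g₂.toFun (δ ε)
    (h X Y M₁ M₂ f₁ f₂ g₁ g₂ ε hε) p q

/-! ### The ambient structure of laws and its open subfunctors -/

namespace BCMStructure

/-- Push-forward of laws along a natural transformation. -/
noncomputable def lawsMap {σ τ : BCMStructure.{u}} (η : σ ⟶ τ) (hσ : σ.Separable)
    (hτ : τ.Separable) : σ.laws hσ ⟶ τ.laws hτ where
  app X :=
    have := hτ X
    ⟨fun μ : ProbabilityMeasure (σ.obj X) =>
        μ.map (η.app X).isEmbedding.continuous.measurable.aemeasurable,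
      isEmbedding_probabilityMeasure_map (η.app X).isEmbedding⟩
  naturality X Y f := by
    apply MTop.Hom.ext
    funext μ
    apply Subtype.ext
    change Measure.map (η.app Y).toFun
        (Measure.map (σ.map f).toFun (μ : ProbabilityMeasure (σ.obj X)).toMeasure) =
      Measure.map (τ.map f).toFun
        (Measure.map (η.app X).toFun (μ : ProbabilityMeasure (σ.obj X)).toMeasure)
    rw [Measure.map_map (η.app Y).isEmbedding.continuous.measurable (measurable_map f),
      Measure.map_map (measurable_map f) (η.app X).isEmbedding.continuous.measurable]
    exact congrArg (fun g : MTop.Hom _ _ => Measure.map g.toFun _) (η.naturality f)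

/-- The laws that give mass more than `r` to an open subfunctor. -/
def lawsGt {τ : BCMStructure.{u}} (S : MTopSubfunctor τ.spaceRooted) (hS : S.Open)
    (hs : τ.Separable) (r : ℝ≥0∞) : MTopSubfunctor (τ.laws hs).spaceRooted where
  carrier X := {μ : ProbabilityMeasure (τ.spaceRooted.obj X) |
    r < (μ : Measure (τ.spaceRooted.obj X)) (S.carrier X)}
  map_mem {X Y} f μ hμ := by
    change r < Measure.map (τ.spaceRooted.map f).toFun
      (μ : ProbabilityMeasure (τ.spaceRooted.obj X)).toMeasure (S.carrier Y)
    rw [Measure.map_apply (τ.spaceRooted.map f).isEmbedding.continuous.measurable (hS Y).measurableSet]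
    exact lt_of_lt_of_le hμ (measure_mono (S.map_mem f))

theorem lawsGt_open {τ : BCMStructure.{u}} (S : MTopSubfunctor τ.spaceRooted) (hS : S.Open)
    (hs : τ.Separable) (r : ℝ≥0∞) : (lawsGt S hS hs r).Open := fun X =>
  ProbabilityMeasure.isOpen_setOf_lt_measure (S := τ.spaceRooted.obj X) (hS X) r

theorem lawsGt_pullbackStable {τ : BCMStructure.{u}} (S : MTopSubfunctor τ.spaceRooted)
    (hS : S.Open) (hp : S.PullbackStable) (hs : τ.Separable) (r : ℝ≥0∞) :
    (lawsGt S hS hs r).PullbackStable := fun {X Y} f => by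
  refine Set.ext fun (μ : ProbabilityMeasure (τ.spaceRooted.obj X)) => ?_
  change r < Measure.map (τ.spaceRooted.map f).toFun μ.toMeasure (S.carrier Y) ↔
    r < μ.toMeasure (S.carrier X)
  rw [Measure.map_apply (τ.spaceRooted.map f).isEmbedding.continuous.measurable (hS Y).measurableSet, hp f]

theorem range_lawsMap {σ τ : BCMStructure.{u}} (η : σ ⟶ τ) (hσ : σ.Separable) (hτ : τ.Separable)
    {S : ℕ → MTopSubfunctor τ.spaceRooted} (hS : ∀ k, (S k).Open) (X : RootedBCM.{u})
    (hη : Set.range (η.app X.space).toFun = ⋂ k, (S k).carrier X) :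
    Set.range ((lawsMap η hσ hτ).app X.space).toFun =
      ⋂ k : ℕ, (lawsGt (S k.unpair.1) (hS _) hτ (1 - (k.unpair.2 + 1 : ℝ≥0∞)⁻¹)).carrier X :=
  ProbabilityMeasure.range_map_eq_iInter (T := τ.obj X.space)
    (η.app X.space).isEmbedding (fun k => hS k X) hη

theorem StablyMetrizable.laws {σ : BCMStructure.{u}} (h : σ.StablyMetrizable) (hs : σ.Separable) :
    (σ.laws hs).StablyMetrizable :=
  let ⟨m, hm⟩ := h
  ⟨m.lawsElementRooted hs, hm.lawsElementRooted hs⟩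

theorem PolishWithPreservedRoots.laws {σ : BCMStructure.{u}} (h : σ.PolishWithPreservedRoots)
    (hσ : σ.Separable) : (σ.laws hσ).PolishWithPreservedRoots := by
  obtain ⟨τ, η, S, ⟨hc, hs, m, hm⟩, hS, hη⟩ := h
  -- Lower semicontinuity of laws needs an element in every `τ(Xₙ)`; the metrization provides it
  -- once any root is chosen.
  have hne : ∀ X : BCM.{u}, Nonempty (τ.obj X) := fun X => m.nonempty ⟨X, Classical.arbitrary X⟩
  exact ⟨τ.laws hs, lawsMap η hσ hs,
    fun k => lawsGt (S k.unpair.1) (hS _).2 hs (1 - (k.unpair.2 + 1 : ℝ≥0∞)⁻¹),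
    ⟨hc.laws hs hne, laws_separable hs, m.laws hs, hm.laws hs⟩,
    fun k => ⟨lawsGt_pullbackStable _ _ (hS _).1 hs _, lawsGt_open _ _ hs _⟩,
    fun X => range_lawsMap η hσ hs (fun k => (hS k).2) X (hη X)⟩

end BCMStructure

theorem mainTheorem12 (σ : BCMStructure.{u}) (hst : σ.StablyMetrizable)
    (hpol : σ.PolishWithPreservedRoots) :
    (σ.laws hpol.separable).StablyMetrizable ∧
      (σ.laws hpol.separable).PolishWithPreservedRoots :=
  ⟨hst.laws _, hpol.laws _⟩
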